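/- \textbf{Theorem (the uniqueness theorem for Cohn path algebras).} Let $k$ be a positive integer and let $\Lambda$ be a $k$-graph: a countable small category with a functor $d$ (degree) to the monoid $\mathbb{N}^k$ such that whenever $d(\lambda)=m+n$ there are unique $\mu,\nu\in\Lambda$ with $\lambda=\mu\nu$, $d(\mu)=m$, $d(\nu)=n$. Morphisms are called paths; $r(\lambda)$ and $s(\lambda)$ denote the codomain and the domain of $\lambda$, and $\lambda\mu$ is defined when $s(\lambda)=r(\mu)$. Write $\Lambda^n=\{\lambda: d(\lambda)=n\}$, identify the set of vertices (objects) with $\Lambda^0$, let $e_1,\dots,e_k$ be the standard basis of $\mathbb{N}^k$, put $\Lambda^1=\bigcup_{i=1}^k\Lambda^{e_i}$, and for $v\in\Lambda^0$ and $E\subseteq\Lambda$ put $vE=\{\lambda\in E: r(\lambda)=v\}$. Assume that $\Lambda$ is row-finite (each $v\Lambda^{e_i}$ is finite) and has no sources ($v\Lambda^{m}\neq\emptyset$ for all $v\in\Lambda^0$, $m\in\mathbb{N}^k$). For paths $\lambda,\mu$ let $\Lambda^{\min}(\lambda,\mu)$ be the (finite) set of pairs $(\nu,\gamma)$ of paths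 with $\lambda\nu=\mu\gamma$ and $d(\lambda\nu)=d(\lambda)\vee d(\mu)$ (coordinatewise maximum). Let $R$ be a commutative ring with $1$. Rings and algebras are associative but need not be unital. The Cohn path algebra $\operatorname{C}_R(\Lambda)$ is the universal $R$-algebra generated by elements $t_\lambda$, $t_{\lambda^*}$ $(\lambda\in\Lambda)$, with $t_{v^*}=t_v$ for $v\in\Lambda^0$, subject to: (CP1) the $t_v$ $(v\in\Lambda^0)$ are mutually orthogonal idempotents; (CP2) $t_\lambda t_\mu=t_{\lambda\mu}$ and $t_{\mu^*}t_{\lambda^*}=t_{(\lambda\mu)^*}$ whenever $s(\lambda)=r(\mu)$; (CP3) $t_{\lambda^*}t_\mu=\sum_{(\nu,\gamma)\in\Lambda^{\min}(\lambda,\mu)}t_\nu t_{\gamma^*}$ for all $\lambda,\mu\in\Lambda$ (an empty sum is $0$). Let $A$ be a ring and let $\phi:\operatorname{C}_R(\Lambda)\to A$ be a ring homomorphism such that $$\phi(r t_v)\neq 0\qquad\text{and}\qquad \phi\Big(r\prod_{e\in v\Lambda^1}(t_v-t_e t_{e^*})\Big)\neq 0$$ for all $r\in R\setminus\{0\}$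 and all $v\in\Lambda^0$ (the product is over a finite non-empty set and its factors commute). Then $\phi$ is injective. -/

import Mathlib

open CategoryTheory

universe u v w w'

/-- A higher-rank graph (`k`-graph) structure on a small category `V`: the category is countable and
carries a degree functor to the monoid `ℕ ^ k` with the unique factorisation property.

Objects of `V` are the vertices and morphisms `f : x ⟶ y` are the paths with source `x` and
range `y`.  The composite `λ μ` of paths with `s(λ) = r(μ)` is `μ ≫ λ` in Mathlib's notation. -/
structure HigherRankGraph (k : ℕ) (V : Type u) [Category.{v} V] where
  countable_vertex : Countable V
  countable_path : ∀ x y : V, Countable (x ⟶ y)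
  /-- the degree map -/
  deg : ∀ {x y : V}, (x ⟶ y) → (Fin k → ℕ)
  deg_id : ∀ x : V, deg (𝟙 x) = 0
  deg_comp : ∀ {x y z : V} (f : x ⟶ y) (g : y ⟶ z), deg (f ≫ g) = deg f + deg g
  /-- Every path `f` of degree `m + n` is uniquely of the form `μ ν` (that is, `ν ≫ μ`) with
  `deg μ = m` and `deg ν = n`; here `p = ⟨z, ν, μ⟩`. -/
  factorisation : ∀ {x y : V} (f : x ⟶ y) (m n : Fin k → ℕ), deg f = m + n →
    ∃! p : Σ z : V, (x ⟶ z) × (z ⟶ y),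
      p.2.1 ≫ p.2.2 = f ∧ deg p.2.2 = m ∧ deg p.2.1 = n

namespace HigherRankGraph

variable {k : ℕ} {V : Type u} [Category.{v} V] (Λ : HigherRankGraph k V)

/-- The set `v Λ ^ n` of paths of degree `n` with range `v`, each with its source. -/
def pathsInto (v : V) (n : Fin k → ℕ) : Set (Σ x : V, x ⟶ v) :=
  {p | Λ.deg p.2 = n}

/-- The set `v Λ ^ 1` of edges (paths whose degree is a standard basis vector) with range `v`. -/
def edgesInto (v : V) : Set (Σ x : V, x ⟶ v) :=
  {p | ∃ i : Fin k, Λ.deg p.2 = Pi.single i 1}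

/-- `Λ` is row-finite: each vertex receives finitely many edges of each colour. -/
class RowFinite : Prop where
  finite : ∀ (v : V) (i : Fin k), (Λ.pathsInto v (Pi.single i 1)).Finite

/-- `Λ` has no sources: each vertex receives paths of every degree. -/
def NoSources : Prop :=
  ∀ (v : V) (m : Fin k → ℕ), (Λ.pathsInto v m).Nonempty

/-- `Λ.minExtSet f g` is the set `Λ^min(f, g)` of minimal common extensions of two paths with a
common range: the pairs `(ν, γ)` with `f ν = g γ` of degree `deg f ∨ deg g`.  Such `ν`, `γ`
automatically have the same source; they are recorded as `p = ⟨source, ν, γ⟩`. -/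
def minExtSet {x y z : V} (f : x ⟶ z) (g : y ⟶ z) : Set (Σ t : V, (t ⟶ x) × (t ⟶ y)) :=
  {p | p.2.1 ≫ f = p.2.2 ≫ g ∧ Λ.deg (p.2.1 ≫ f) = Λ.deg f ⊔ Λ.deg g}

theorem eq_id_of_deg_eq_zero {x y : V} (f : x ⟶ y) (hf : Λ.deg f = 0) :
    (⟨x, f⟩ : Σ x : V, x ⟶ y) = ⟨y, 𝟙 y⟩ := by
  obtain ⟨p, -, hp⟩ := Λ.factorisation f 0 0 (by simpa using hf)
  have h1 := hp ⟨x, 𝟙 x, f⟩ ⟨Category.id_comp f, hf, Λ.deg_id x⟩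
  have h2 := hp ⟨y, f, 𝟙 y⟩ ⟨Category.comp_id f, Λ.deg_id y, hf⟩
  have h3 := h1.trans h2.symm
  exact congrArg (fun q : Σ z : V, (x ⟶ z) × (z ⟶ y) => (⟨q.1, q.2.2⟩ : Σ x : V, x ⟶ y)) h3

theorem pathsInto_finite [Λ.RowFinite] (n : Fin k → ℕ) (v : V) : (Λ.pathsInto v n).Finite := by
  induction hN : ∑ i, n i generalizing n v with
  | zero =>
    have hn : n = 0 := by
      funext i
      have := Finset.single_le_sum (f := n) (fun j _ => Nat.zero_le _) (Finset.mem_univ i)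
      simpa [hN] using this
    subst hn
    exact (Set.finite_singleton _).subset fun p hp => Λ.eq_id_of_deg_eq_zero p.2 hp
  | succ N ih =>
    obtain ⟨i, hi⟩ : ∃ i, n i ≠ 0 := by
      by_contra! h
      simp [h] at hN
    have hle : Pi.single i 1 ≤ n := by
      intro j
      by_cases hj : j = i
      · subst hj; simpa using Nat.one_le_iff_ne_zero.mpr hi
      · simp [hj]
    obtain ⟨m, rfl⟩ := exists_add_of_le hle
    have hm : ∑ j, m j = N := by
      simp [Finset.sum_add_distrib] at hN
      omega
    have hfin : (⋃ e ∈ Λ.pathsInto v (Pi.single i 1),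
        (fun q : Σ x : V, x ⟶ e.1 => (⟨q.1, q.2 ≫ e.2⟩ : Σ x : V, x ⟶ v)) ''
          Λ.pathsInto e.1 m).Finite :=
      (RowFinite.finite v i).biUnion fun e _ => (ih m e.1 hm).image _
    refine hfin.subset fun p hp => ?_
    obtain ⟨⟨z, q, e⟩, ⟨hqe, he, hq⟩, -⟩ := Λ.factorisation p.2 (Pi.single i 1) m hp
    simp only [Set.mem_iUnion]
    exact ⟨⟨z, e⟩, he, ⟨p.1, q⟩, hq, congrArg (Sigma.mk p.1) hqe⟩

theorem edgesInto_finite [Λ.RowFinite] (v : V) : (Λ.edgesInto v).Finite :=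
  (Set.finite_iUnion fun i => RowFinite.finite (Λ := Λ) v i).subset fun _ ⟨i, hi⟩ =>
    Set.mem_iUnion.mpr ⟨i, hi⟩

theorem minExtSet_finite [Λ.RowFinite] {x y z : V} (f : x ⟶ z) (g : y ⟶ z) :
    (Λ.minExtSet f g).Finite := by
  have hfin := (Λ.pathsInto_finite (Λ.deg f ⊔ Λ.deg g - Λ.deg f) x).prod
    (Λ.pathsInto_finite (Λ.deg f ⊔ Λ.deg g - Λ.deg g) y)
  refine Set.Finite.of_finite_image (f := fun p : Σ t : V, (t ⟶ x) × (t ⟶ y) =>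
    ((⟨p.1, p.2.1⟩ : Σ t : V, t ⟶ x), (⟨p.1, p.2.2⟩ : Σ t : V, t ⟶ y))) (hfin.subset ?_) ?_
  · rintro _ ⟨p, ⟨h1, h2⟩, rfl⟩
    have h3 := h2
    rw [h1] at h3
    rw [Λ.deg_comp] at h2 h3
    exact ⟨by simp [pathsInto, ← h2], by simp [pathsInto, ← h3]⟩
  · rintro ⟨t, a, b⟩ - ⟨t', a', b'⟩ - h
    simp only [Prod.mk.injEq, Sigma.mk.injEq] at h
    obtain ⟨⟨rfl, h1⟩, -, h2⟩ := h
    rw [eq_of_heq h1, eq_of_heq h2]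

/-- `Λ^min(f, g)` as a finite set. -/
noncomputable def minExt [Λ.RowFinite] {x y z : V} (f : x ⟶ z) (g : y ⟶ z) :
    Finset (Σ t : V, (t ⟶ x) × (t ⟶ y)) :=
  (Λ.minExtSet_finite f g).toFinset

/-- A Cohn `Λ`-family in a ring `A`: `T f` is the element `T_f` attached to the path `f` and `S f`
is the element `T_{f*}` attached to its ghost path, where `v* = v` for vertices `v`. -/
structure IsCohnFamily [Λ.RowFinite] {A : Type w} [NonUnitalRing A]
    (T S : ∀ {x y : V}, (x ⟶ y) → A) : Prop where
  ghost_vertex : ∀ v : V, S (𝟙 v) = T (𝟙 v)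
  /-- (CP1) the `T_v` are mutually orthogonal idempotents -/
  vertex_idem : ∀ v : V, T (𝟙 v) * T (𝟙 v) = T (𝟙 v)
  vertex_orth : ∀ v w : V, v ≠ w → T (𝟙 v) * T (𝟙 w) = 0
  /-- (CP2) `T_f T_g = T_{fg}` and `T_{g*} T_{f*} = T_{(fg)*}` whenever `s(f) = r(g)` -/
  path_mul : ∀ {x y z : V} (g : x ⟶ y) (f : y ⟶ z), T f * T g = T (g ≫ f)
  ghost_mul : ∀ {x y z : V} (g : x ⟶ y) (f : y ⟶ z), S g * S f = S (g ≫ f)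
  /-- (CP3) `T_{f*} T_g = ∑ T_ν T_{γ*}` over `(ν, γ) ∈ Λ^min(f, g)`; if `f` and `g` have
  different ranges then `Λ^min(f, g)` is empty and the sum is zero -/
  ghost_path : ∀ {x y z : V} (f : x ⟶ z) (g : y ⟶ z),
    S f * T g = ∑ p ∈ Λ.minExt f g, T p.2.1 * S p.2.2
  ghost_path_of_ne : ∀ {x y z z' : V} (f : x ⟶ z) (g : y ⟶ z'), z ≠ z' → S f * T g = 0

namespace IsCohnFamily

variable {Λ} [Λ.RowFinite] {A : Type w} [NonUnitalRing A] {T S : ∀ {x y : V}, (x ⟶ y) → A}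

theorem range_proj_mul (h : Λ.IsCohnFamily T S) {x y z : V} (f : x ⟶ z) (g : y ⟶ z) :
    (T f * S f) * (T g * S g) = ∑ p ∈ Λ.minExt f g, T (p.2.1 ≫ f) * S (p.2.1 ≫ f) := by
  rw [mul_assoc, ← mul_assoc (S f), h.ghost_path, Finset.sum_mul, Finset.mul_sum]
  refine Finset.sum_congr rfl fun p hp => ?_
  have hp' : p.2.1 ≫ f = p.2.2 ≫ g := by
    have : p ∈ Λ.minExtSet f g := by simpa [minExt] using hp
    exact this.1
  rw [mul_assoc, h.ghost_mul, ← mul_assoc, h.path_mul, hp']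

theorem range_proj_comm (h : Λ.IsCohnFamily T S) {x y z : V} (f : x ⟶ z) (g : y ⟶ z) :
    (T f * S f) * (T g * S g) = (T g * S g) * (T f * S f) := by
  rw [h.range_proj_mul, h.range_proj_mul]
  refine Finset.sum_bij' (fun p _ => ⟨p.1, p.2.2, p.2.1⟩) (fun p _ => ⟨p.1, p.2.2, p.2.1⟩)
    ?_ ?_ ?_ ?_ ?_
  · intro p hp
    obtain ⟨h1, h2⟩ : p ∈ Λ.minExtSet f g := by simpa [minExt] using hp
    simp only [minExt, Set.Finite.mem_toFinset]
    exact ⟨h1.symm, by rw [sup_comm, ← h1]; exact h2⟩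
  · intro p hp
    obtain ⟨h1, h2⟩ : p ∈ Λ.minExtSet g f := by simpa [minExt] using hp
    simp only [minExt, Set.Finite.mem_toFinset]
    exact ⟨h1.symm, by rw [sup_comm, ← h1]; exact h2⟩
  · intro p _; rfl
  · intro p _; rfl
  · intro p hp
    obtain ⟨h1, -⟩ : p ∈ Λ.minExtSet f g := by simpa [minExt] using hp
    simp only [h1]

theorem vertex_mul (h : Λ.IsCohnFamily T S) {x z : V} (f : x ⟶ z) : T (𝟙 z) * T f = T f := by
  rw [h.path_mul, Category.comp_id]

theorem ghost_mul_vertex (h : Λ.IsCohnFamily T S) {x z : V} (f : x ⟶ z) :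
    S f * T (𝟙 z) = S f := by
  rw [← h.ghost_vertex, h.ghost_mul, Category.comp_id]

theorem gap_comm (h : Λ.IsCohnFamily T S) {x y z : V} (f : x ⟶ z) (g : y ⟶ z) :
    (T (𝟙 z) - T f * S f) * (T (𝟙 z) - T g * S g) =
      (T (𝟙 z) - T g * S g) * (T (𝟙 z) - T f * S f) := by
  have e1 : ∀ {x : V} (f : x ⟶ z), T (𝟙 z) * (T f * S f) = T f * S f := fun f => by
    rw [← mul_assoc, h.vertex_mul]
  have e2 : ∀ {x : V} (f : x ⟶ z), T f * S f * T (𝟙 z) = T f * S f := fun f => by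
    rw [mul_assoc, h.ghost_mul_vertex]
  simp only [mul_sub, sub_mul, e1, e2, h.range_proj_comm f g]
  abel

/-- The product `∏_{e ∈ v Λ^1} (T_v - T_e T_{e*})`.  The factors commute by `gap_comm`, so the
order does not matter.  Since `A` need not be unital, the product is started at `T_v`, which is an
identity for every factor; when `v Λ^1` is non-empty this start value does not change the
product. -/
noncomputable def edgeProd (h : Λ.IsCohnFamily T S) (v : V) : A :=
  ((Λ.edgesInto_finite v).toFinset.val.map fun e => T (𝟙 v) - T e.2 * S e.2).noncommFold (· * ·)
    (by
      intro a ha b hb _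
      obtain ⟨e, -, rfl⟩ := Multiset.mem_map.mp ha
      obtain ⟨f, -, rfl⟩ := Multiset.mem_map.mp hb
      exact h.gap_comm e.2 f.2)
    (T (𝟙 v))

end IsCohnFamily

/-! ### The Cohn path algebra -/

/-- The free (non-unital, associative) `R`-algebra on the paths and ghost paths: the free
`R`-module on the non-empty words, with multiplication by concatenation. -/
abbrev FreePathAlgebra (R : Type w) [CommRing R] (V : Type u) [Category.{v} V] :
    Type (max u v w) :=
  MonoidAlgebra R (FreeSemigroup ((Σ x y : V, x ⟶ y) ⊕ (Σ x y : V, x ⟶ y)))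

/-- The generator given by a path. -/
noncomputable def freePath (R : Type w) [CommRing R] {x y : V} (f : x ⟶ y) :
    FreePathAlgebra R V :=
  MonoidAlgebra.single (FreeSemigroup.of (Sum.inl ⟨x, y, f⟩)) 1

/-- The generator given by a ghost path. -/
noncomputable def freeGhost (R : Type w) [CommRing R] {x y : V} (f : x ⟶ y) :
    FreePathAlgebra R V :=
  MonoidAlgebra.single (FreeSemigroup.of (Sum.inr ⟨x, y, f⟩)) 1

/-- The defining relations of the Cohn path algebra: those of a Cohn `Λ`-family. -/
inductive CohnRel (R : Type w) [CommRing R] [Λ.RowFinite] :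
    FreePathAlgebra R V → FreePathAlgebra R V → Prop
  | ghost_vertex (v : V) : CohnRel R (freeGhost R (𝟙 v)) (freePath R (𝟙 v))
  | vertex_idem (v : V) :
      CohnRel R (freePath R (𝟙 v) * freePath R (𝟙 v)) (freePath R (𝟙 v))
  | vertex_orth (v w : V) (h : v ≠ w) :
      CohnRel R (freePath R (𝟙 v) * freePath R (𝟙 w)) 0
  | path_mul {x y z : V} (g : x ⟶ y) (f : y ⟶ z) :
      CohnRel R (freePath R f * freePath R g) (freePath R (g ≫ f))
  | ghost_mul {x y z : V} (g : x ⟶ y) (f : y ⟶ z) :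
      CohnRel R (freeGhost R g * freeGhost R f) (freeGhost R (g ≫ f))
  | ghost_path {x y z : V} (f : x ⟶ z) (g : y ⟶ z) :
      CohnRel R (freeGhost R f * freePath R g)
        (∑ p ∈ Λ.minExt f g, freePath R p.2.1 * freeGhost R p.2.2)
  | ghost_path_of_ne {x y z z' : V} (f : x ⟶ z) (g : y ⟶ z') (h : z ≠ z') :
      CohnRel R (freeGhost R f * freePath R g) 0

/-- The `R`-algebra congruence generated by the defining relations.  (Scalar multiples of the
relations are put in because a ring congruence on a non-unital algebra need not be stable under
scalars.) -/
noncomputable def cohnCon (R : Type w) [CommRing R] [Λ.RowFinite] : RingCon (FreePathAlgebra R V) :=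
  ringConGen fun a b => ∃ (r : R) (a' b' : FreePathAlgebra R V),
    CohnRel Λ R a' b' ∧ a = r • a' ∧ b = r • b'

theorem cohnCon_smul (R : Type w) [CommRing R] [Λ.RowFinite] (r : R) {a b : FreePathAlgebra R V}
    (h : Λ.cohnCon R a b) : Λ.cohnCon R (r • a) (r • b) := by
  have h' : RingConGen.Rel _ a b := h
  change RingConGen.Rel _ (r • a) (r • b)
  induction h' with
  | of a b hab =>
    obtain ⟨s, a', b', hr, rfl, rfl⟩ := hab
    exact RingConGen.Rel.of _ _ ⟨r * s, a', b', hr, (mul_smul _ _ _).symm, (mul_smul _ _ _).symm⟩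
  | refl a => exact RingConGen.Rel.refl _
  | symm _ ih => exact RingConGen.Rel.symm (ih ‹_›)
  | trans _ _ ih1 ih2 => exact RingConGen.Rel.trans (ih1 ‹_›) (ih2 ‹_›)
  | add _ _ ih1 ih2 =>
    rw [smul_add, smul_add]
    exact RingConGen.Rel.add (ih1 ‹_›) (ih2 ‹_›)
  | mul _ h2 ih1 _ =>
    rw [← smul_mul_assoc, ← smul_mul_assoc]
    exact RingConGen.Rel.mul (ih1 ‹_›) h2

/-- The Cohn path algebra `C_R(Λ)`: the quotient of the free algebra on paths and ghost paths by
the defining relations of a Cohn `Λ`-family. -/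
def CohnPathAlgebra (R : Type w) [CommRing R] [Λ.RowFinite] : Type (max u v w) :=
  (Λ.cohnCon R).Quotient

namespace CohnPathAlgebra

variable (R : Type w) [CommRing R] [Λ.RowFinite]

noncomputable instance : NonUnitalRing (Λ.CohnPathAlgebra R) :=
  inferInstanceAs (NonUnitalRing (Λ.cohnCon R).Quotient)

/-- The quotient map from the free algebra. -/
noncomputable def mk : FreePathAlgebra R V →ₙ+* Λ.CohnPathAlgebra R where
  toFun a := ((a : (Λ.cohnCon R).Quotient) : (Λ.cohnCon R).Quotient)
  map_mul' _ _ := rfl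
  map_zero' := rfl
  map_add' _ _ := rfl

theorem mk_surjective : Function.Surjective (mk Λ R) := fun x =>
  Quotient.inductionOn' x fun a => ⟨a, rfl⟩

theorem mk_eq_mk {a b : FreePathAlgebra R V} : mk Λ R a = mk Λ R b ↔ Λ.cohnCon R a b :=
  (Λ.cohnCon R).eq

noncomputable instance : SMul R (Λ.CohnPathAlgebra R) where
  smul r := Quotient.map' (fun a => r • a) fun _ _ h => Λ.cohnCon_smul R r h

theorem mk_smul (r : R) (a : FreePathAlgebra R V) : mk Λ R (r • a) = r • mk Λ R a := rfl

noncomputable instance : Module R (Λ.CohnPathAlgebra R) :=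
  Function.Surjective.module R (mk Λ R : FreePathAlgebra R V →+ Λ.CohnPathAlgebra R)
    (mk_surjective Λ R) (mk_smul Λ R)

instance : IsScalarTower R (Λ.CohnPathAlgebra R) (Λ.CohnPathAlgebra R) where
  smul_assoc r x y := by
    obtain ⟨a, rfl⟩ := mk_surjective Λ R x
    obtain ⟨b, rfl⟩ := mk_surjective Λ R y
    simp only [smul_eq_mul, ← mk_smul, ← map_mul, smul_mul_assoc]

instance : SMulCommClass R (Λ.CohnPathAlgebra R) (Λ.CohnPathAlgebra R) where
  smul_comm r x y := by
    obtain ⟨a, rfl⟩ := mk_surjective Λ R x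
    obtain ⟨b, rfl⟩ := mk_surjective Λ R y
    simp only [smul_eq_mul, ← mk_smul, ← map_mul, mul_smul_comm]

/-- The generator `t_f` of `C_R(Λ)`. -/
noncomputable def t {x y : V} (f : x ⟶ y) : Λ.CohnPathAlgebra R :=
  mk Λ R (freePath R f)

/-- The generator `t_{f*}` of `C_R(Λ)`. -/
noncomputable def tGhost {x y : V} (f : x ⟶ y) : Λ.CohnPathAlgebra R :=
  mk Λ R (freeGhost R f)

theorem mk_eq_of_rel {a b : FreePathAlgebra R V} (h : CohnRel Λ R a b) : mk Λ R a = mk Λ R b :=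
  (mk_eq_mk Λ R).mpr (RingConGen.Rel.of _ _ ⟨1, a, b, h, (one_smul _ _).symm, (one_smul _ _).symm⟩)

theorem isCohnFamily : Λ.IsCohnFamily (t Λ R) (tGhost Λ R) where
  ghost_vertex v := mk_eq_of_rel Λ R (.ghost_vertex v)
  vertex_idem v := (map_mul _ _ _).symm.trans (mk_eq_of_rel Λ R (.vertex_idem v))
  vertex_orth v w h :=
    ((map_mul _ _ _).symm.trans (mk_eq_of_rel Λ R (.vertex_orth v w h))).trans (map_zero _)
  path_mul g f := (map_mul _ _ _).symm.trans (mk_eq_of_rel Λ R (.path_mul g f))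
  ghost_mul g f := (map_mul _ _ _).symm.trans (mk_eq_of_rel Λ R (.ghost_mul g f))
  ghost_path f g := by
    refine ((map_mul _ _ _).symm.trans (mk_eq_of_rel Λ R (.ghost_path f g))).trans ?_
    simp only [map_sum, map_mul, t, tGhost]
  ghost_path_of_ne f g h :=
    ((map_mul _ _ _).symm.trans (mk_eq_of_rel Λ R (.ghost_path_of_ne f g h))).trans (map_zero _)

/-- `C_R(Λ)` is the universal `R`-algebra generated by a Cohn `Λ`-family. -/
theorem existsUnique_lift {A : Type w'} [NonUnitalRing A] [Module R A] [IsScalarTower R A A]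
    [SMulCommClass R A A] {T S : ∀ {x y : V}, (x ⟶ y) → A} (h : Λ.IsCohnFamily T S) :
    ∃! φ : Λ.CohnPathAlgebra R →ₙₐ[R] A,
      (∀ {x y : V} (f : x ⟶ y), φ (t Λ R f) = T f) ∧
      ∀ {x y : V} (f : x ⟶ y), φ (tGhost Λ R f) = S f := by
  let π : FreePathAlgebra R V →ₙₐ[R] A := MonoidAlgebra.liftMagma R
    (FreeSemigroup.lift (Sum.elim (fun p => T p.2.2) (fun p => S p.2.2)))
  have hT : ∀ {x y : V} (f : x ⟶ y), π (freePath R f) = T f := fun f => by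
    simp [π, freePath, MonoidAlgebra.liftMagma]
  have hS : ∀ {x y : V} (f : x ⟶ y), π (freeGhost R f) = S f := fun f => by
    simp [π, freeGhost, MonoidAlgebra.liftMagma]
  have hrel : ∀ a b, CohnRel Λ R a b → π a = π b := by
    intro a b hab
    induction hab with
    | ghost_vertex v => rw [hT, hS, h.ghost_vertex]
    | vertex_idem v => rw [map_mul, hT, h.vertex_idem]
    | vertex_orth v w hvw => rw [map_mul, hT, hT, h.vertex_orth v w hvw, map_zero]
    | path_mul g f => rw [map_mul, hT, hT, hT, h.path_mul]
    | ghost_mul g f => rw [map_mul, hS, hS, hS, h.ghost_mul]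
    | ghost_path f g => simp only [map_mul, map_sum, hT, hS, h.ghost_path]
    | ghost_path_of_ne f g hne => rw [map_mul, hT, hS, h.ghost_path_of_ne f g hne, map_zero]
  have hcon : ∀ a b, Λ.cohnCon R a b → π a = π b := by
    intro a b hab
    have hab' : RingConGen.Rel _ a b := hab
    clear hab
    induction hab' with
    | of a b hab =>
      obtain ⟨s, a', b', hr, rfl, rfl⟩ := hab
      rw [map_smul, map_smul, hrel _ _ hr]
    | refl a => rfl
    | symm _ ih => exact ih.symm
    | trans _ _ ih1 ih2 => exact ih1.trans ih2
    | add _ _ ih1 ih2 => rw [map_add, map_add, ih1, ih2]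
    | mul _ _ ih1 ih2 => rw [map_mul, map_mul, ih1, ih2]
  let F : Λ.CohnPathAlgebra R → A := fun x => Quotient.liftOn' x π hcon
  have hF : ∀ a, F (mk Λ R a) = π a := fun _ => rfl
  refine ⟨{ toFun := F, map_smul' := ?_, map_zero' := ?_, map_add' := ?_, map_mul' := ?_ },
    ⟨hT, hS⟩, ?_⟩
  · intro r x
    obtain ⟨a, rfl⟩ := mk_surjective Λ R x
    rw [← mk_smul, hF, hF, map_smul]; rfl
  · rw [← map_zero (mk Λ R), hF, map_zero]
  · intro x y
    obtain ⟨a, rfl⟩ := mk_surjective Λ R x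
    obtain ⟨b, rfl⟩ := mk_surjective Λ R y
    rw [← map_add, hF, hF, hF, map_add]
  · intro x y
    obtain ⟨a, rfl⟩ := mk_surjective Λ R x
    obtain ⟨b, rfl⟩ := mk_surjective Λ R y
    rw [← map_mul, hF, hF, hF, map_mul]
  · rintro ψ ⟨h1, h2⟩
    let q : FreePathAlgebra R V →ₙₐ[R] Λ.CohnPathAlgebra R :=
      { mk Λ R with map_smul' := mk_smul Λ R }
    have hq : ψ.comp q = π := by
      refine MonoidAlgebra.nonUnitalAlgHom_ext' R (FreeSemigroup.hom_ext ?_)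
      funext p
      rcases p with ⟨x, y, f⟩ | ⟨x, y, f⟩
      · exact (h1 f).trans (hT f).symm
      · exact (h2 f).trans (hS f).symm
    ext x
    obtain ⟨a, rfl⟩ := mk_surjective Λ R x
    exact DFunLike.congr_fun hq a

end CohnPathAlgebra

end HigherRankGraph

/-!
Write `Q v = ∏_{e ∈ v Λ^1} (t_v - t_e t_{e*})`.  Every path of non-zero degree begins with an edge,
so `t_{f*} Q v = 0 = Q v t_f` whenever `deg f ≠ 0` (`ghost_mul_edgeProd`, `edgeProd_mul_path`).
Consequently, in the representation of the algebra on paths, the elements `t_α (Q v) t_{β*}` act as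
matrix units, and compressing by them reads off matrix coefficients: the element
`Q v t_{α*} (t_γ t_{δ*}) t_β Q v` vanishes unless `α = γ ν` and `β = δ ν` for one and the same path
`ν` (`exists_factor_of_compression_ne_zero`), and it equals `Q v` if `(γ, δ) = (α, β)`.

By (CP3) the elements `t_γ t_{δ*}` with `s(γ) = s(δ)` span the algebra (`span_pathGhost`).  Given a
non-zero combination of them, choose a pair `(α, β)` in its support for which `deg β` has the least
total.  Any other pair `(γ, δ)` in the support with `α = γ ν`, `β = δ ν` would have `deg ν ≠ 0` and
hence a smaller total, so the compression by `(α, β)` is `r • Q v` with `r ≠ 0` the coefficient of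
`(α, β)`.  If the combination lies in the kernel of `φ`, so does `r • Q v`, against the hypothesis.
-/

namespace HigherRankGraph

variable {k : ℕ} {V : Type u} [Category.{v} V] (Λ : HigherRankGraph k V)

/-! ### Cancellation and factorisation of paths -/

theorem comp_right_cancel (Λ : HigherRankGraph k V) {x y z : V} {f g : x ⟶ y} (h : y ⟶ z) (hfg : f ≫ h = g ≫ h) :
    f = g := by
  have hd : Λ.deg g = Λ.deg f := by
    have := congrArg Λ.deg hfg
    rw [Λ.deg_comp, Λ.deg_comp] at this
    exact (add_right_cancel this).symm
  have hu := (Λ.factorisation (f ≫ h) (Λ.deg h) (Λ.deg f)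
    (by rw [Λ.deg_comp, add_comm])).unique
    (y₁ := ⟨y, f, h⟩) (y₂ := ⟨y, g, h⟩) ⟨rfl, rfl, rfl⟩ ⟨hfg.symm, rfl, hd⟩
  simpa using hu

theorem exists_edge_factor {x z : V} (f : x ⟶ z) (hf : Λ.deg f ≠ 0) :
    ∃ (y : V) (g : x ⟶ y) (e : y ⟶ z), (⟨y, e⟩ : Σ y : V, y ⟶ z) ∈ Λ.edgesInto z ∧ g ≫ e = f := by
  obtain ⟨i, hi⟩ := Function.ne_iff.mp hf
  have hle : Pi.single i 1 ≤ Λ.deg f := by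
    intro j
    by_cases hj : j = i
    · subst hj; simpa using Nat.one_le_iff_ne_zero.mpr hi
    · simp [hj]
  obtain ⟨m, hm⟩ := exists_add_of_le hle
  obtain ⟨⟨y, g, e⟩, ⟨hge, he, -⟩, -⟩ := Λ.factorisation f _ _ hm
  exact ⟨y, g, e, ⟨i, he⟩, hge⟩

theorem mem_minExt [Λ.RowFinite] {x y z : V} {f : x ⟶ z} {g : y ⟶ z}
    {p : Σ t : V, (t ⟶ x) × (t ⟶ y)} :
    p ∈ Λ.minExt f g ↔ p.2.1 ≫ f = p.2.2 ≫ g ∧ Λ.deg (p.2.1 ≫ f) = Λ.deg f ⊔ Λ.deg g := by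
  simp [minExt, minExtSet]

/-- If one path extends another, it is their only minimal common extension.  With (CP3) this gives
`t_{f*} t_{f g} = t_g`. -/
theorem minExt_comp_self [Λ.RowFinite] {x y z : V} (g : x ⟶ y) (f : y ⟶ z) :
    Λ.minExt f (g ≫ f) = {⟨x, g, 𝟙 x⟩} := by
  have hsup : Λ.deg f ⊔ Λ.deg (g ≫ f) = Λ.deg (g ≫ f) :=
    sup_eq_right.mpr (by rw [Λ.deg_comp]; exact le_add_self)
  ext ⟨t, a, b⟩
  rw [mem_minExt, Finset.mem_singleton, hsup]
  constructor
  · rintro ⟨h1, h2⟩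
    dsimp only at h1 h2
    have hb : Λ.deg b = 0 := by
      rw [h1, Λ.deg_comp b] at h2
      simpa using h2
    obtain ⟨rfl, hb'⟩ := Sigma.mk.inj (Λ.eq_id_of_deg_eq_zero b hb)
    obtain rfl := eq_of_heq hb'
    rw [Category.id_comp] at h1
    rw [Λ.comp_right_cancel f h1]
  · intro h
    cases h
    simp

/-! ### The gap projections of a Cohn family -/

namespace IsCohnFamily

variable {Λ} [Λ.RowFinite] {A : Type w} [NonUnitalRing A] {T S : ∀ {x y : V}, (x ⟶ y) → A}

theorem ghost_mul_comp (h : Λ.IsCohnFamily T S) {x y z : V} (g : x ⟶ y) (f : y ⟶ z) :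
    S f * T (g ≫ f) = T g := by
  rw [h.ghost_path, minExt_comp_self, Finset.sum_singleton, h.ghost_vertex, h.path_mul,
    Category.id_comp]

theorem ghost_mul_self (h : Λ.IsCohnFamily T S) {x z : V} (f : x ⟶ z) : S f * T f = T (𝟙 x) := by
  simpa using h.ghost_mul_comp (𝟙 x) f

theorem gap_mul_self (h : Λ.IsCohnFamily T S) {x v : V} (f : x ⟶ v) :
    (T (𝟙 v) - T f * S f) * (T (𝟙 v) - T f * S f) = T (𝟙 v) - T f * S f := by
  have e : T f * S f * (T f * S f) = T f * S f := by
    rw [mul_assoc, ← mul_assoc (S f), h.ghost_mul_self, ← mul_assoc, h.path_mul, Category.id_comp]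
  rw [mul_sub, sub_mul, sub_mul, e, h.vertex_idem, mul_assoc, h.ghost_mul_vertex, ← mul_assoc,
    h.vertex_mul, sub_self, sub_zero]

/-- The product `edgeProd` is opened only through this principle and `gap_mul_edgeProd`: each gap
`T_v - T_e T_{e*}` may be pulled to the front because the gaps commute. -/
theorem edgeProd_induction (h : Λ.IsCohnFamily T S) (v : V) {P : A → Prop} (hv : P (T (𝟙 v)))
    (hmul : ∀ e ∈ Λ.edgesInto v, ∀ a, P a → P ((T (𝟙 v) - T e.2 * S e.2) * a)) :
    P (h.edgeProd v) := by
  -- Generalised to an arbitrary multiset of gaps, as the induction removes them one at a time.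
  have key : ∀ (s : Multiset A) (hs : ∀ a ∈ s, ∃ e ∈ Λ.edgesInto v, T (𝟙 v) - T e.2 * S e.2 = a)
      (hc : {a | a ∈ s}.Pairwise fun a b => a * b = b * a),
      P (s.noncommFold (· * ·) hc (T (𝟙 v))) := by
    intro s
    induction s using Multiset.induction with
    | empty => intro _ _; exact hv
    | cons a s ih =>
      intro hs hc
      obtain ⟨e, he, rfl⟩ := hs a (Multiset.mem_cons_self a s)
      rw [Multiset.noncommFold_cons (· * ·) s _ hc
        (hc.mono fun b hb => Multiset.mem_cons_of_mem hb)]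
      exact hmul e he _ (ih (fun b hb => hs b (Multiset.mem_cons_of_mem hb)) _)
  refine key _ (fun a ha => ?_) _
  obtain ⟨e, hmem, he⟩ := Multiset.mem_map.mp ha
  exact ⟨e, by simpa using hmem, he⟩

theorem vertex_mul_edgeProd (h : Λ.IsCohnFamily T S) (v : V) :
    T (𝟙 v) * h.edgeProd v = h.edgeProd v := by
  refine h.edgeProd_induction v (P := fun a => T (𝟙 v) * a = a) (h.vertex_idem v) fun e _ a _ => ?_
  rw [← mul_assoc, mul_sub, h.vertex_idem, ← mul_assoc, h.vertex_mul]

theorem gap_mul_edgeProd (h : Λ.IsCohnFamily T S) {v : V} {e : Σ x : V, x ⟶ v}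
    (he : e ∈ Λ.edgesInto v) :
    (T (𝟙 v) - T e.2 * S e.2) * h.edgeProd v = h.edgeProd v := by
  have key : ∀ (s : Multiset A) (hs : T (𝟙 v) - T e.2 * S e.2 ∈ s)
      (hc : {a | a ∈ s}.Pairwise fun a b => a * b = b * a),
      (T (𝟙 v) - T e.2 * S e.2) * s.noncommFold (· * ·) hc (T (𝟙 v)) =
        s.noncommFold (· * ·) hc (T (𝟙 v)) := by
    intro s hs hc
    obtain ⟨s, rfl⟩ := Multiset.exists_cons_of_mem hs
    rw [Multiset.noncommFold_cons (· * ·) s _ hc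
      (hc.mono fun b hb => Multiset.mem_cons_of_mem hb), ← mul_assoc, h.gap_mul_self]
  exact key _ (Multiset.mem_map_of_mem (fun e : Σ x : V, x ⟶ v => T (𝟙 v) - T e.2 * S e.2)
    (by simpa using he)) _

theorem edgeProd_mul_gap (h : Λ.IsCohnFamily T S) {v : V} {e : Σ x : V, x ⟶ v}
    (he : e ∈ Λ.edgesInto v) :
    h.edgeProd v * (T (𝟙 v) - T e.2 * S e.2) = h.edgeProd v := by
  have hcomm : h.edgeProd v * (T (𝟙 v) - T e.2 * S e.2) =
      (T (𝟙 v) - T e.2 * S e.2) * h.edgeProd v := by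
    refine h.edgeProd_induction v (P := fun a => a * (T (𝟙 v) - T e.2 * S e.2) =
      (T (𝟙 v) - T e.2 * S e.2) * a) ?_ fun e' _ a ha => ?_
    · rw [mul_sub, sub_mul, ← mul_assoc _ (T e.2), h.vertex_mul e.2, mul_assoc (T e.2),
        h.ghost_mul_vertex]
    · rw [mul_assoc, ha, ← mul_assoc, h.gap_comm, mul_assoc]
  rw [hcomm, h.gap_mul_edgeProd he]

theorem ghost_mul_edgeProd (h : Λ.IsCohnFamily T S) {x v : V} (f : x ⟶ v) (hf : Λ.deg f ≠ 0) :
    S f * h.edgeProd v = 0 := by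
  obtain ⟨y, g, e, he, rfl⟩ := Λ.exists_edge_factor f hf
  have : S e * (T (𝟙 v) - T e * S e) = 0 := by
    rw [mul_sub, h.ghost_mul_vertex, ← mul_assoc, h.ghost_mul_self, ← h.ghost_vertex, h.ghost_mul,
      Category.id_comp, sub_self]
  rw [← h.gap_mul_edgeProd he, ← h.ghost_mul, mul_assoc, ← mul_assoc (S e), this, zero_mul,
    mul_zero]

theorem edgeProd_mul_path (h : Λ.IsCohnFamily T S) {x v : V} (f : x ⟶ v) (hf : Λ.deg f ≠ 0) :
    h.edgeProd v * T f = 0 := by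
  obtain ⟨y, g, e, he, rfl⟩ := Λ.exists_edge_factor f hf
  have : (T (𝟙 v) - T e * S e) * T e = 0 := by
    rw [sub_mul, h.vertex_mul, mul_assoc, h.ghost_mul_self, h.path_mul, Category.id_comp, sub_self]
  rw [← h.edgeProd_mul_gap he, ← h.path_mul, mul_assoc, ← mul_assoc _ (T e), this, zero_mul,
    mul_zero]

theorem edgeProd_mul_self (h : Λ.IsCohnFamily T S) (v : V) :
    h.edgeProd v * h.edgeProd v = h.edgeProd v := by
  refine h.edgeProd_induction v (P := fun a => a * h.edgeProd v = h.edgeProd v)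
    (h.vertex_mul_edgeProd v) fun e he a ha => ?_
  rw [mul_assoc, ha, h.gap_mul_edgeProd he]

/-- On the gap projection at its source, a path behaves like a basis vector of the path
representation: the ghost of `f` kills `T g * Q` unless `g` has the form `f a`.  The equality of
the ranges is part of the conclusion, hence the `eqToHom`. -/
theorem exists_factor_of_ghost_mul_path_mul_edgeProd_ne_zero (h : Λ.IsCohnFamily T S)
    {x y w z : V} (f : x ⟶ y) (g : w ⟶ z) (hne : S f * (T g * h.edgeProd w) ≠ 0) :
    ∃ hyz : y = z, ∃ a : w ⟶ x, a ≫ f ≫ eqToHom hyz = g := by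
  by_cases hyz : y = z
  · subst hyz
    refine ⟨rfl, ?_⟩
    by_contra! hno
    apply hne
    rw [← mul_assoc, h.ghost_path, Finset.sum_mul]
    refine Finset.sum_eq_zero ?_
    rintro ⟨t, a, b⟩ hp
    have hp := Λ.mem_minExt.mp hp
    -- In a term with `deg b = 0` the path `b` is a vertex, so `a` would be a factor of `g`.
    have hb : Λ.deg b ≠ 0 := by
      intro hb
      obtain ⟨rfl, hb'⟩ := Sigma.mk.inj (Λ.eq_id_of_deg_eq_zero b hb)
      obtain rfl := eq_of_heq hb'
      exact hno a (by simpa using hp.1)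
    dsimp only
    rw [mul_assoc, h.ghost_mul_edgeProd b hb, mul_zero]
  · rw [← mul_assoc, h.ghost_path_of_ne f g hyz, zero_mul] at hne
    exact absurd rfl hne

/-- A non-zero matrix coefficient of `T c * S d` at the pair of paths `(a, b)` comes from a common
continuation `n` with `a = n ≫ c` and `b = n ≫ d`. -/
theorem exists_factor_of_compression_ne_zero (h : Λ.IsCohnFamily T S)
    {v x y z x' y' : V} (a : v ⟶ x) (b : v ⟶ y) (c : z ⟶ x') (d : z ⟶ y')
    (hne : h.edgeProd v * (S a * ((T c * S d) * (T b * h.edgeProd v))) ≠ 0) :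
    ∃ (hx : x' = x) (hy : y' = y) (n : v ⟶ z),
      n ≫ c ≫ eqToHom hx = a ∧ n ≫ d ≫ eqToHom hy = b := by
  rw [mul_assoc (T c)] at hne
  obtain ⟨rfl, n, rfl⟩ := h.exists_factor_of_ghost_mul_path_mul_edgeProd_ne_zero d b (by
    intro h0
    simp [h0] at hne)
  simp only [eqToHom_refl, Category.comp_id] at hne
  rw [← mul_assoc (S d), h.ghost_mul_comp, ← mul_assoc (T c), h.path_mul] at hne
  obtain ⟨rfl, m, hm⟩ := h.exists_factor_of_ghost_mul_path_mul_edgeProd_ne_zero a (n ≫ c) (by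
    intro h0
    simp [h0] at hne)
  simp only [eqToHom_refl, Category.comp_id] at hm
  rw [← hm, ← mul_assoc (S a), h.ghost_mul_comp, ← mul_assoc] at hne
  have hd : Λ.deg m = 0 := by
    by_contra hd
    rw [h.edgeProd_mul_path m hd, zero_mul] at hne
    exact hne rfl
  have := Λ.eq_id_of_deg_eq_zero m hd
  obtain rfl : m = 𝟙 v := by simpa using this
  exact ⟨rfl, rfl, n, by simpa using hm.symm, by simp⟩

theorem compression_self (h : Λ.IsCohnFamily T S) {v x y : V} (a : v ⟶ x) (b : v ⟶ y) :
    h.edgeProd v * (S a * ((T a * S b) * (T b * h.edgeProd v))) = h.edgeProd v := by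
  rw [mul_assoc (T a), ← mul_assoc (S b), h.ghost_mul_self, h.vertex_mul_edgeProd,
    ← mul_assoc (S a), h.ghost_mul_self, h.vertex_mul_edgeProd, h.edgeProd_mul_self]

end IsCohnFamily

/-! ### The spanning set of the Cohn path algebra -/

namespace CohnPathAlgebra

variable (R : Type w) [CommRing R] [Λ.RowFinite]

/-- The element `t_α t_{β*}` attached to a pair of paths with a common source, recorded as
`⟨source, α, β⟩` with the range of each path. -/
noncomputable def pathGhost (p : Σ z : V, (Σ x : V, z ⟶ x) × (Σ y : V, z ⟶ y)) :
    Λ.CohnPathAlgebra R :=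
  t Λ R p.2.1.2 * tGhost Λ R p.2.2.2

theorem pathGhost_mul_mem_span (p q : Σ z : V, (Σ x : V, z ⟶ x) × (Σ y : V, z ⟶ y)) :
    pathGhost Λ R p * pathGhost Λ R q ∈ Submodule.span R (Set.range (pathGhost Λ R)) := by
  have h := isCohnFamily Λ R
  obtain ⟨z, ⟨x, a⟩, ⟨y, b⟩⟩ := p
  obtain ⟨z', ⟨x', c⟩, ⟨y', d⟩⟩ := q
  change t Λ R a * tGhost Λ R b * (t Λ R c * tGhost Λ R d) ∈ _
  rw [mul_assoc, ← mul_assoc (tGhost Λ R b)]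
  by_cases hyx : y = x'
  · subst hyx
    rw [h.ghost_path, Finset.sum_mul, Finset.mul_sum]
    refine Submodule.sum_mem _ fun m _ => Submodule.subset_span
      ⟨⟨m.1, ⟨x, m.2.1 ≫ a⟩, ⟨y', m.2.2 ≫ d⟩⟩, ?_⟩
    rw [mul_assoc, h.ghost_mul, ← mul_assoc, h.path_mul]
    rfl
  · rw [h.ghost_path_of_ne b c hyx, zero_mul, mul_zero]
    exact Submodule.zero_mem _

theorem span_pathGhost_mul_mem {a b : Λ.CohnPathAlgebra R}
    (ha : a ∈ Submodule.span R (Set.range (pathGhost Λ R)))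
    (hb : b ∈ Submodule.span R (Set.range (pathGhost Λ R))) :
    a * b ∈ Submodule.span R (Set.range (pathGhost Λ R)) := by
  induction ha, hb using Submodule.span_induction₂ with
  | mem_mem x y hx hy =>
    obtain ⟨p, rfl⟩ := hx
    obtain ⟨q, rfl⟩ := hy
    exact pathGhost_mul_mem_span Λ R p q
  | zero_left y hy => rw [zero_mul]; exact Submodule.zero_mem _
  | zero_right x hx => rw [mul_zero]; exact Submodule.zero_mem _
  | add_left x y z _ _ _ h1 h2 => rw [add_mul]; exact Submodule.add_mem _ h1 h2
  | add_right x y z _ _ _ h1 h2 => rw [mul_add]; exact Submodule.add_mem _ h1 h2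
  | smul_left r x y _ _ h1 => rw [smul_mul_assoc]; exact Submodule.smul_mem _ r h1
  | smul_right r x y _ _ h1 => rw [mul_smul_comm]; exact Submodule.smul_mem _ r h1

theorem span_pathGhost : Submodule.span R (Set.range (pathGhost Λ R)) = ⊤ := by
  have h := isCohnFamily Λ R
  have hword : ∀ s : FreeSemigroup ((Σ x y : V, x ⟶ y) ⊕ (Σ x y : V, x ⟶ y)),
      mk Λ R (MonoidAlgebra.single s 1) ∈ Submodule.span R (Set.range (pathGhost Λ R)) := by
    intro s
    induction s using FreeSemigroup.recOnMul with
    | ih1 g =>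
      rcases g with ⟨x, y, f⟩ | ⟨x, y, f⟩
      · refine Submodule.subset_span ⟨⟨x, ⟨y, f⟩, ⟨x, 𝟙 x⟩⟩, ?_⟩
        change t Λ R f * tGhost Λ R (𝟙 x) = t Λ R f
        rw [h.ghost_vertex, h.path_mul, Category.id_comp]
      · refine Submodule.subset_span ⟨⟨x, ⟨x, 𝟙 x⟩, ⟨y, f⟩⟩, ?_⟩
        change t Λ R (𝟙 x) * tGhost Λ R f = tGhost Λ R f
        rw [← h.ghost_vertex, h.ghost_mul, Category.id_comp]
    | ih2 g s hg hs =>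
      have : (MonoidAlgebra.single (FreeSemigroup.of g * s) 1 : FreePathAlgebra R V) =
          MonoidAlgebra.single (FreeSemigroup.of g) 1 * MonoidAlgebra.single s 1 := by
        rw [MonoidAlgebra.single_mul_single, one_mul]
      rw [this, map_mul]
      exact span_pathGhost_mul_mem Λ R hg hs
  rw [eq_top_iff]
  rintro a -
  obtain ⟨a, rfl⟩ := mk_surjective Λ R a
  induction a using MonoidAlgebra.induction_linear with
  | zero => rw [map_zero]; exact Submodule.zero_mem _
  | add f g hf hg => rw [map_add]; exact Submodule.add_mem _ hf hg
  | single s r =>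
    have : (MonoidAlgebra.single s r : FreePathAlgebra R V) = r • MonoidAlgebra.single s 1 := by
      simp
    rw [this, mk_smul]
    exact Submodule.smul_mem _ r (hword s)

/-- Every non-zero element is carried to a non-zero multiple of some gap projection by
multiplication on both sides. -/
theorem exists_compression_eq_smul_edgeProd {a : Λ.CohnPathAlgebra R} (ha : a ≠ 0) :
    ∃ (r : R) (v : V) (b c : Λ.CohnPathAlgebra R), r ≠ 0 ∧
      b * a * c = r • (isCohnFamily Λ R).edgeProd v := by
  classical
  have h := isCohnFamily Λ R
  have hmem : a ∈ Submodule.span R (Set.range (pathGhost Λ R)) := by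
    rw [span_pathGhost]; trivial
  obtain ⟨l, rfl⟩ := Finsupp.mem_span_range_iff_exists_finsupp.mp hmem
  have hl : l.support.Nonempty := by
    rw [Finsupp.support_nonempty_iff]
    rintro rfl
    simp at ha
  obtain ⟨p, hp, hmin⟩ :=
    Finset.exists_min_image l.support (fun p => ∑ i, Λ.deg p.2.2.2 i) hl
  obtain ⟨v, ⟨x, α⟩, ⟨y, β⟩⟩ := p
  refine ⟨l ⟨v, ⟨x, α⟩, ⟨y, β⟩⟩, v, h.edgeProd v * tGhost Λ R α, t Λ R β * h.edgeProd v,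
    Finsupp.mem_support_iff.mp hp, ?_⟩
  rw [mul_assoc, mul_assoc, Finsupp.sum, Finset.sum_mul, Finset.mul_sum, Finset.mul_sum,
    Finset.sum_eq_single_of_mem _ hp]
  · rw [smul_mul_assoc, mul_smul_comm, mul_smul_comm]
    congr 1
    exact h.compression_self α β
  · rintro ⟨z, ⟨x', γ⟩, ⟨y', δ⟩⟩ hq hqp
    rw [smul_mul_assoc, mul_smul_comm, mul_smul_comm]
    by_contra hne
    obtain ⟨rfl, rfl, n, hα, hβ⟩ := h.exists_factor_of_compression_ne_zero α β γ δ
      (right_ne_zero_of_smul hne)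
    simp only [eqToHom_refl, Category.comp_id] at hα hβ
    -- Minimality of `(α, β)` forces the common continuation `n` to be a vertex.
    have hle := hmin _ hq
    subst hα hβ
    simp only [Λ.deg_comp, Pi.add_apply, Finset.sum_add_distrib] at hle
    have hn : Λ.deg n = 0 := by
      have h0 : ∑ i, Λ.deg n i = 0 := by omega
      funext i
      exact (Finset.sum_eq_zero_iff.mp h0) i (Finset.mem_univ i)
    obtain ⟨rfl, hn'⟩ := Sigma.mk.inj (Λ.eq_id_of_deg_eq_zero n hn)
    obtain rfl := eq_of_heq hn'
    simp at hqp

end CohnPathAlgebra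

end HigherRankGraph

/-- The uniqueness theorem for Cohn path algebras. -/
theorem mainTheorem1 {k : ℕ} (hk : 0 < k) {V : Type u} [Category.{v} V]
    (Λ : HigherRankGraph k V) [Λ.RowFinite] (hΛ : Λ.NoSources)
    {R : Type w} [CommRing R] {A : Type w'} [NonUnitalRing A]
    (φ : Λ.CohnPathAlgebra R →ₙ+* A)
    (hvertex : ∀ (r : R) (v : V), r ≠ 0 →
      φ (r • HigherRankGraph.CohnPathAlgebra.t Λ R (𝟙 v)) ≠ 0)
    (hprod : ∀ (r : R) (v : V), r ≠ 0 →
      φ (r • (HigherRankGraph.CohnPathAlgebra.isCohnFamily Λ R).edgeProd v) ≠ 0) :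
    Function.Injective φ := by
  rw [injective_iff_map_eq_zero]
  intro a ha
  by_contra hne
  obtain ⟨r, v, b, c, hr, hbc⟩ :=
    HigherRankGraph.CohnPathAlgebra.exists_compression_eq_smul_edgeProd Λ R hne
  apply hprod r v hr
  rw [← hbc, map_mul, map_mul, ha, mul_zero, zero_mul]
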